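/- Let $A\to M$ be a smooth real vector bundle of finite rank over a finite-dimensional smooth manifold, and let $\mu$ be a Lie algebroid structure on $A$, with anchor $\rho$ and bracket $[\cdot,\cdot]$ on $\Gamma(A)$. Let $\omega_1,\omega_2,\omega_3\in\Gamma(\wedge^2A^*)$ be non-degenerate $2$-forms, let $\omega_i^\flat:A\to A^*$, $\langle\omega_i^\flat(X),Y\rangle=\omega_i(X,Y)$, and let $\pi_i$ be the inverse of $\omega_i$, so that $\pi_i^\sharp=(\omega_i^\flat)^{-1}$. With indices taken modulo $3$, define the transition morphisms $$N_i:=\pi_{i-1}^\sharp\circ\omega_{i+1}^\flat: A\to A,\qquad i=1,2,3 .$$ For $\varepsilon_1,\varepsilon_2,\varepsilon_3\in\{1,-1\}$, the triplet $(\omega_1,\omega_2,\omega_3)$ is an $\boldsymbol\varepsilon$-hypersymplectic structure with torsion on a Lie algebroid $(A,\nu)$ if $$N_i^2=\varepsilon_i\,\mathrm{id}_A\quad(i=1,2,3)\qquad\text{and}\qquad \varepsilon_2\,N_1\mathrm{d}\omega_1=\varepsilon_3\,N_2\mathrm{d}\omega_2=\varepsilon_1\,N_3\mathrm{d}\omega_3,$$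 where $\mathrm{d}$ is the differential of $(A,\nu)$ and $N_i\mathrm{d}\omega_i(X,Y,Z):=\mathrm{d}\omega_i(N_iX,N_iY,N_iZ)$. It is a *hypersymplectic structure with torsion* if $\varepsilon_1=\varepsilon_2=\varepsilon_3=-1$, and a *para-hypersymplectic structure with torsion* if $\varepsilon_1\varepsilon_2\varepsilon_3=-1$ but the $\varepsilon_i$ are not all equal to $-1$. For $i\in\{1,2,3\}$ let $\mu_{N_i}$ be the deformation of $\mu$ by $N_i$: its anchor is $\rho\circ N_i$ and its bracket is $$[X,Y]_{N_i}=[N_iX,Y]+[X,N_iY]-N_i[X,Y],\qquad X,Y\in\Gamma(A).$$ **Theorem.** Fix $\varepsilon_1,\varepsilon_2,\varepsilon_3$. For each $i\in\{1,2,3\}$, the following are equivalent: 1. $(\omega_1,\omega_2,\omega_3)$ is a hypersymplectic structure with torsion on $(A,\mu)$; 2. $\mu_{N_i}$ is a Lie algebroid structure on $A$ and $(\omega_1,\omega_2,\omega_3)$ is a hypersymplectic structure with torsion on $(A,\mu_{N_i})$. The same equivalence holds with "para-hypersymplectic" in place of "hypersymplectic", for the same $\varepsilon_i$ on both sides. 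-/

import Mathlib

open Bundle
open scoped Manifold ContDiff

noncomputable section

namespace LieAlgebroidHST

section Inverse

variable {E : Type*} [NormedAddCommGroup E] [NormedSpace ℝ E]
  {M : Type*} [TopologicalSpace M] [ChartedSpace E M]
  {F : Type*} [NormedAddCommGroup F] [NormedSpace ℝ F]
  {V : M → Type*} [TopologicalSpace (TotalSpace F V)] [∀ x, AddCommGroup (V x)]
  [∀ x, Module ℝ (V x)] [∀ x, TopologicalSpace (V x)]
  [∀ x, IsTopologicalAddGroup (V x)] [∀ x, ContinuousSMul ℝ (V x)]
  [FiberBundle F V] [VectorBundle ℝ F V]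
  {F' : Type*} [NormedAddCommGroup F'] [NormedSpace ℝ F']
  {W : M → Type*} [TopologicalSpace (TotalSpace F' W)] [∀ x, AddCommGroup (W x)]
  [∀ x, Module ℝ (W x)] [∀ x, TopologicalSpace (W x)]
  [∀ x, IsTopologicalAddGroup (W x)] [∀ x, ContinuousSMul ℝ (W x)]
  [FiberBundle F' W] [VectorBundle ℝ F' W]

/-- If `a` and `b` are smooth vector bundle morphisms `V → W` and `a` is fibrewise invertible, then
`a⁻¹ ∘ b` is a smooth vector bundle morphism `V → V`. -/
theorem contMDiff_inverse_comp [CompleteSpace F] (a b : ∀ x : M, V x →L[ℝ] W x)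
    (ha : ContMDiff 𝓘(ℝ, E) (𝓘(ℝ, E).prod 𝓘(ℝ, F →L[ℝ] F')) ∞
      (fun x ↦ TotalSpace.mk' (F →L[ℝ] F') (E := fun x : M ↦ (V x →L[ℝ] W x)) x (a x)))
    (hb : ContMDiff 𝓘(ℝ, E) (𝓘(ℝ, E).prod 𝓘(ℝ, F →L[ℝ] F')) ∞
      (fun x ↦ TotalSpace.mk' (F →L[ℝ] F') (E := fun x : M ↦ (V x →L[ℝ] W x)) x (b x)))
    (hinv : ∀ x, (a x).IsInvertible) :
    ContMDiff 𝓘(ℝ, E) (𝓘(ℝ, E).prod 𝓘(ℝ, F →L[ℝ] F)) ∞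
      (fun x ↦ TotalSpace.mk' (F →L[ℝ] F) (E := fun x : M ↦ (V x →L[ℝ] V x)) x
        ((a x).inverse ∘L b x)) := by
  intro x₀
  have ha' := ((contMDiffAt_hom_bundle _).1 (ha x₀)).2
  have hb' := ((contMDiffAt_hom_bundle _).1 (hb x₀)).2
  refine (contMDiffAt_hom_bundle _).2 ⟨contMDiffAt_id, ?_⟩
  have key : ∀ x, x ∈ (trivializationAt F V x₀).baseSet →
      x ∈ (trivializationAt F' W x₀).baseSet →
      ContinuousLinearMap.inCoordinates F V F V x₀ x x₀ x ((a x).inverse ∘L b x) =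
        (ContinuousLinearMap.inCoordinates F V F' W x₀ x x₀ x (a x)).inverse ∘L
          ContinuousLinearMap.inCoordinates F V F' W x₀ x x₀ x (b x) := by
    intro x hV hW
    rw [ContinuousLinearMap.inCoordinates_eq hV hV, ContinuousLinearMap.inCoordinates_eq hV hW,
      ContinuousLinearMap.inCoordinates_eq hV hW, ContinuousLinearMap.inverse_equiv_comp,
      ContinuousLinearMap.inverse_comp_equiv]
    ext v
    simp only [ContinuousLinearMap.comp_apply, ContinuousLinearEquiv.coe_coe,
      ContinuousLinearEquiv.symm_apply_apply, ContinuousLinearEquiv.symm_symm]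
  have hinv₀ : (ContinuousLinearMap.inCoordinates F V F' W x₀ x₀ x₀ x₀ (a x₀)).IsInvertible := by
    rw [ContinuousLinearMap.inCoordinates_eq (FiberBundle.mem_baseSet_trivializationAt' x₀)
      (FiberBundle.mem_baseSet_trivializationAt' x₀)]
    simpa using hinv x₀
  have h1 : ContMDiffAt 𝓘(ℝ, E) 𝓘(ℝ, F' →L[ℝ] F) ∞
      (fun x ↦ (ContinuousLinearMap.inCoordinates F V F' W x₀ x x₀ x (a x)).inverse) x₀ :=
    ContMDiffAt.comp (I' := 𝓘(ℝ, F →L[ℝ] F')) x₀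
      (g := (ContinuousLinearMap.inverse : (F →L[ℝ] F') → (F' →L[ℝ] F)))
      (hinv₀.contDiffAt_map_inverse.contMDiffAt) ha'
  refine (h1.clm_comp hb').congr_of_eventuallyEq ?_
  filter_upwards [(trivializationAt F V x₀).open_baseSet.mem_nhds
      (FiberBundle.mem_baseSet_trivializationAt' x₀),
    (trivializationAt F' W x₀).open_baseSet.mem_nhds
      (FiberBundle.mem_baseSet_trivializationAt' x₀)] with x hV hW
  exact key x hV hW

/-- The composition of smooth vector bundle morphisms `a : V → V` and `b : V → W` is smooth. -/
theorem contMDiff_comp (a : ∀ x : M, V x →L[ℝ] V x) (b : ∀ x : M, V x →L[ℝ] W x)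
    (ha : ContMDiff 𝓘(ℝ, E) (𝓘(ℝ, E).prod 𝓘(ℝ, F →L[ℝ] F)) ∞
      (fun x ↦ TotalSpace.mk' (F →L[ℝ] F) (E := fun x : M ↦ (V x →L[ℝ] V x)) x (a x)))
    (hb : ContMDiff 𝓘(ℝ, E) (𝓘(ℝ, E).prod 𝓘(ℝ, F →L[ℝ] F')) ∞
      (fun x ↦ TotalSpace.mk' (F →L[ℝ] F') (E := fun x : M ↦ (V x →L[ℝ] W x)) x (b x))) :
    ContMDiff 𝓘(ℝ, E) (𝓘(ℝ, E).prod 𝓘(ℝ, F →L[ℝ] F')) ∞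
      (fun x ↦ TotalSpace.mk' (F →L[ℝ] F') (E := fun x : M ↦ (V x →L[ℝ] W x)) x
        (b x ∘L a x)) := by
  intro x₀
  have ha' := ((contMDiffAt_hom_bundle _).1 (ha x₀)).2
  have hb' := ((contMDiffAt_hom_bundle _).1 (hb x₀)).2
  refine (contMDiffAt_hom_bundle _).2 ⟨contMDiffAt_id, ?_⟩
  refine (hb'.clm_comp ha').congr_of_eventuallyEq ?_
  filter_upwards [(trivializationAt F V x₀).open_baseSet.mem_nhds
      (FiberBundle.mem_baseSet_trivializationAt' x₀),
    (trivializationAt F' W x₀).open_baseSet.mem_nhds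
      (FiberBundle.mem_baseSet_trivializationAt' x₀)] with x hV hW
  change ContinuousLinearMap.inCoordinates F V F' W x₀ x x₀ x (b x ∘L a x) =
    ContinuousLinearMap.inCoordinates F V F' W x₀ x x₀ x (b x) ∘L
      ContinuousLinearMap.inCoordinates F V F V x₀ x x₀ x (a x)
  rw [ContinuousLinearMap.inCoordinates_eq hV hW, ContinuousLinearMap.inCoordinates_eq hV hW,
    ContinuousLinearMap.inCoordinates_eq hV hV]
  ext v
  simp only [ContinuousLinearMap.comp_apply, ContinuousLinearEquiv.coe_coe,
    ContinuousLinearEquiv.symm_apply_apply]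

end Inverse

section Main

variable (E : Type*) [NormedAddCommGroup E] [NormedSpace ℝ E]
  {M : Type*} [TopologicalSpace M] [ChartedSpace E M]
  (F : Type*) [NormedAddCommGroup F] [NormedSpace ℝ F]
  (V : M → Type*) [TopologicalSpace (TotalSpace F V)] [∀ x, AddCommGroup (V x)]
  [∀ x, Module ℝ (V x)] [∀ x, TopologicalSpace (V x)]
  [∀ x, IsTopologicalAddGroup (V x)] [∀ x, ContinuousSMul ℝ (V x)]
  [FiberBundle F V] [VectorBundle ℝ F V]

/-- The space `Γ(A)` of smooth sections of the vector bundle `A → M` with fibres `V x`. -/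
abbrev Sections : Type _ := ContMDiffSection 𝓘(ℝ, E) F ∞ V

variable {E F V} in
/-- The section `f X` for a smooth function `f` and a section `X`. -/
def smulSection (f : C^∞⟮𝓘(ℝ, E), M; ℝ⟯) (X : Sections E F V) : Sections E F V :=
  ⟨fun x ↦ f x • X x, f.contMDiff.smul_section X.contMDiff⟩

/-- Smooth vector bundle endomorphisms `N : A → A` over the identity of `M`. -/
abbrev BundleEnd : Type _ :=
  ContMDiffSection 𝓘(ℝ, E) (F →L[ℝ] F) ∞ (fun x : M ↦ V x →L[ℝ] V x)

variable {E F V} in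
/-- The section `N X`. -/
def BundleEnd.apply (N : BundleEnd E F V) (X : Sections E F V) : Sections E F V :=
  ⟨fun x ↦ N x (X x), N.contMDiff.clm_bundle_apply X.contMDiff⟩

variable {E F V} in
theorem BundleEnd.apply_add (N : BundleEnd E F V) (X Y : Sections E F V) :
    N.apply (X + Y) = N.apply X + N.apply Y :=
  ContMDiffSection.ext fun x ↦ map_add (N x) (X x) (Y x)

variable {E F V} in
theorem BundleEnd.apply_smul (N : BundleEnd E F V) (c : ℝ) (X : Sections E F V) :
    N.apply (c • X) = c • N.apply X :=
  ContMDiffSection.ext fun x ↦ map_smul (N x) c (X x)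

variable {E F V} in
theorem BundleEnd.apply_smulSection (N : BundleEnd E F V) (f : C^∞⟮𝓘(ℝ, E), M; ℝ⟯)
    (X : Sections E F V) : N.apply (smulSection f X) = smulSection f (N.apply X) :=
  ContMDiffSection.ext fun x ↦ map_smul (N x) (f x) (X x)

/-- A (smooth) non-degenerate `2`-form on `A`, that is, a non-degenerate `Ω ∈ Γ(⋀² A*)`. -/
structure NondegenerateTwoForm where
  /-- the bilinear form on each fibre; as a map `V x → (V x)*` it is `Ω^♭` -/
  flat (x : M) : V x →L[ℝ] V x →L[ℝ] ℝ
  alternating (x : M) (v : V x) : flat x v v = 0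
  nondegenerate (x : M) (v : V x) : (∀ w : V x, flat x v w = 0) → v = 0
  contMDiff : ContMDiff 𝓘(ℝ, E) (𝓘(ℝ, E).prod 𝓘(ℝ, F →L[ℝ] F →L[ℝ] ℝ)) ∞
    (fun x ↦ TotalSpace.mk' (F →L[ℝ] F →L[ℝ] ℝ)
      (E := fun x : M ↦ (V x →L[ℝ] V x →L[ℝ] ℝ)) x (flat x))

variable {E} in
/-- The derivative at `x` of a function `f` along the tangent vector `v`. -/
def derivAlong (f : M → ℝ) (x : M) (v : TangentSpace 𝓘(ℝ, E) x) : ℝ :=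
  mfderiv 𝓘(ℝ, E) 𝓘(ℝ, ℝ) f x v

/-- A pre-Lie algebroid structure `μ` on the vector bundle `A → M`: an `ℝ`-bilinear skew-symmetric
bracket on `Γ(A)` and an anchor `ρ : A → TM` (a smooth vector bundle morphism) satisfying the
Leibniz rule `[X, f Y] = f [X, Y] + (ρ(X) f) Y`. -/
structure PreLieAlgebroid [IsManifold 𝓘(ℝ, E) ∞ M] where
  bracket : Sections E F V →ₗ[ℝ] Sections E F V →ₗ[ℝ] Sections E F V
  bracket_self (X : Sections E F V) : bracket X X = 0
  anchor : ContMDiffSection 𝓘(ℝ, E) (F →L[ℝ] E) ∞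
    (fun x : M ↦ V x →L[ℝ] TangentSpace 𝓘(ℝ, E) x)
  leibniz (X Y : Sections E F V) (f : C^∞⟮𝓘(ℝ, E), M; ℝ⟯) (x : M) :
    bracket X (smulSection f Y) x =
      f x • bracket X Y x + derivAlong f x (anchor x (X x)) • Y x

variable {E F V}

/-- `Ω^♭` is fibrewise invertible; its inverse is `π^♯`, for `π` the inverse of `Ω`. -/
theorem NondegenerateTwoForm.isInvertible [FiniteDimensional ℝ F]
    (Ω : NondegenerateTwoForm E F V) (x : M) : (Ω.flat x).IsInvertible := by
  let e : V x ≃L[ℝ] F := (trivializationAt F V x).continuousLinearEquivAt ℝ x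
    (FiberBundle.mem_baseSet_trivializationAt' x)
  let e' : (V x →L[ℝ] ℝ) ≃L[ℝ] (F →L[ℝ] ℝ) := e.arrowCongr (ContinuousLinearEquiv.refl ℝ ℝ)
  let B : F →L[ℝ] (F →L[ℝ] ℝ) :=
    (e' : (V x →L[ℝ] ℝ) →L[ℝ] (F →L[ℝ] ℝ)) ∘L Ω.flat x ∘L (e.symm : F →L[ℝ] V x)
  have hinj : Function.Injective (B : F →ₗ[ℝ] (F →L[ℝ] ℝ)) := by
    refine (injective_iff_map_eq_zero (B : F →ₗ[ℝ] (F →L[ℝ] ℝ))).2 fun v hv ↦ ?_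
    have h0 : Ω.flat x (e.symm v) = 0 := e'.map_eq_zero_iff.1 hv
    have h1 : e.symm v = 0 := Ω.nondegenerate x _ fun w ↦ by rw [h0]; rfl
    exact e.symm.map_eq_zero_iff.1 h1
  have hdim : Module.finrank ℝ F = Module.finrank ℝ (F →L[ℝ] ℝ) := by
    rw [← Subspace.dual_finrank_eq (K := ℝ) (V := F)]
    exact (LinearMap.toContinuousLinearMap : (F →ₗ[ℝ] ℝ) ≃ₗ[ℝ] (F →L[ℝ] ℝ)).finrank_eq
  have hB : B.IsInvertible :=
    ⟨(LinearEquiv.ofInjectiveOfFinrankEq (B : F →ₗ[ℝ] (F →L[ℝ] ℝ)) hinj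
      hdim).toContinuousLinearEquiv, by ext; rfl⟩
  simpa [B] using hB

/-- The transition morphism `N i = π_{i-1}^♯ ∘ Ω_{i+1}^♭`, where `π_j^♯ = (Ω_j^♭)⁻¹`; the indices
`1, 2, 3` are taken modulo `3`. -/
def transition [FiniteDimensional ℝ F] (Ω : ZMod 3 → NondegenerateTwoForm E F V) (i : ZMod 3) :
    BundleEnd E F V :=
  haveI : CompleteSpace F := FiniteDimensional.complete ℝ F
  ⟨fun x ↦ ((Ω (i - 1)).flat x).inverse ∘L (Ω (i + 1)).flat x,
    contMDiff_inverse_comp (W := fun x ↦ V x →L[ℝ] ℝ) _ _ (Ω (i - 1)).contMDiff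
      (Ω (i + 1)).contMDiff (Ω (i - 1)).isInvertible⟩

namespace NondegenerateTwoForm

/-- The function `Ω(X, Y)` on `M`. -/
def eval (Ω : NondegenerateTwoForm E F V) (X Y : Sections E F V) : M → ℝ :=
  fun x ↦ Ω.flat x (X x) (Y x)

end NondegenerateTwoForm

namespace PreLieAlgebroid

variable [IsManifold 𝓘(ℝ, E) ∞ M]

/-- The function `ρ(X) f`. -/
def anchorDeriv (μ : PreLieAlgebroid E F V) (X : Sections E F V) (f : M → ℝ) : M → ℝ :=
  fun x ↦ derivAlong f x (μ.anchor x (X x))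

/-- `μ` is a Lie algebroid structure: the Jacobi identity holds. (That the anchor preserves
brackets is then a consequence of the Leibniz rule.) -/
def IsLieAlgebroid (μ : PreLieAlgebroid E F V) : Prop :=
  ∀ X Y Z : Sections E F V,
    μ.bracket X (μ.bracket Y Z) + μ.bracket Y (μ.bracket Z X) + μ.bracket Z (μ.bracket X Y) = 0

/-- The value on sections of the `3`-form `dΩ`, with `d` the differential of `μ`. -/
def d (μ : PreLieAlgebroid E F V) (Ω : NondegenerateTwoForm E F V) (X Y Z : Sections E F V) :
    M → ℝ :=
  μ.anchorDeriv X (Ω.eval Y Z) - μ.anchorDeriv Y (Ω.eval X Z) + μ.anchorDeriv Z (Ω.eval X Y)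
    - Ω.eval (μ.bracket X Y) Z + Ω.eval (μ.bracket X Z) Y - Ω.eval (μ.bracket Y Z) X

/-- The deformed structure `μ_N`, with bracket `[X, Y]_N = [N X, Y] + [X, N Y] - N [X, Y]` and
anchor `ρ ∘ N`. -/
def deform (μ : PreLieAlgebroid E F V) (N : BundleEnd E F V) : PreLieAlgebroid E F V where
  bracket := LinearMap.mk₂ ℝ
    (fun X Y ↦ μ.bracket (N.apply X) Y + μ.bracket X (N.apply Y) - N.apply (μ.bracket X Y))
    (fun X X' Y ↦ by simp only [N.apply_add, map_add, LinearMap.add_apply]; abel)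
    (fun c X Y ↦ by
      simp only [N.apply_smul, map_smul, LinearMap.smul_apply, smul_add, smul_sub])
    (fun X Y Y' ↦ by simp only [N.apply_add, map_add]; abel)
    (fun c X Y ↦ by simp only [N.apply_smul, map_smul, smul_add, smul_sub])
  bracket_self X := by
    have h0 : N.apply (0 : Sections E F V) = 0 := by
      simpa using N.apply_smul 0 (0 : Sections E F V)
    have h := μ.bracket_self (N.apply X + X)
    simp only [map_add, LinearMap.add_apply, μ.bracket_self, zero_add, add_zero] at h
    rw [LinearMap.mk₂_apply, μ.bracket_self, h0, sub_zero, ← h]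
    abel
  anchor := ⟨fun x ↦ μ.anchor x ∘L N x, contMDiff_comp _ _ N.contMDiff μ.anchor.contMDiff⟩
  leibniz X Y f x := by
    simp only [LinearMap.mk₂_apply, N.apply_smulSection, ContMDiffSection.coe_add,
      ContMDiffSection.coe_sub, Pi.add_apply, Pi.sub_apply, μ.leibniz]
    have h : N.apply (μ.bracket X (smulSection f Y)) x =
        f x • N.apply (μ.bracket X Y) x
          + derivAlong f x (μ.anchor x (X x)) • N.apply Y x := by
      change N x (μ.bracket X (smulSection f Y) x) = _
      rw [μ.leibniz, map_add, map_smul, map_smul]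
      rfl
    rw [h]
    change _ = _ + derivAlong f x (μ.anchor x (N.apply X x)) • Y x
    simp only [smul_add, smul_sub]
    abel

end PreLieAlgebroid

variable [IsManifold 𝓘(ℝ, E) ∞ M]

/-- The triplet `(Ω 1, Ω 2, Ω 3)` is an `ε`-hypersymplectic structure with torsion on the Lie
algebroid `(A, μ)`, where `ε i = ±1`: `(N i)² = ε i · id` for `i = 1, 2, 3`, and
`ε 2 · N 1 dΩ 1 = ε 3 · N 2 dΩ 2 = ε 1 · N 3 dΩ 3`, where
`N i dΩ i (X, Y, Z) = dΩ i (N i X, N i Y, N i Z)`. -/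
structure IsEpsHST [FiniteDimensional ℝ F] (μ : PreLieAlgebroid E F V) (ε : ZMod 3 → ℝ)
    (Ω : ZMod 3 → NondegenerateTwoForm E F V) : Prop where
  isLieAlgebroid : μ.IsLieAlgebroid
  eps (i : ZMod 3) : ε i = 1 ∨ ε i = -1
  sq (i : ZMod 3) (x : M) (v : V x) : transition Ω i x (transition Ω i x v) = ε i • v
  torsion (i j : ZMod 3) (X Y Z : Sections E F V) :
    ε (i + 1) • μ.d (Ω i) ((transition Ω i).apply X) ((transition Ω i).apply Y)
        ((transition Ω i).apply Z) =
      ε (j + 1) • μ.d (Ω j) ((transition Ω j).apply X) ((transition Ω j).apply Y)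
        ((transition Ω j).apply Z)

/-- Hypersymplectic structures with torsion: the case `ε 1 = ε 2 = ε 3 = -1`. -/
def IsHypersymplecticWithTorsion [FiniteDimensional ℝ F] (μ : PreLieAlgebroid E F V)
    (ε : ZMod 3 → ℝ) (Ω : ZMod 3 → NondegenerateTwoForm E F V) : Prop :=
  IsEpsHST μ ε Ω ∧ ∀ i, ε i = -1

/-- Para-hypersymplectic structures with torsion: `ε 1 ε 2 ε 3 = -1`, but not all `ε i` are
equal to `-1`. -/
def IsParaHypersymplecticWithTorsion [FiniteDimensional ℝ F] (μ : PreLieAlgebroid E F V)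
    (ε : ZMod 3 → ℝ) (Ω : ZMod 3 → NondegenerateTwoForm E F V) : Prop :=
  IsEpsHST μ ε Ω ∧ ε 1 * ε 2 * ε 3 = -1 ∧ ¬ ∀ i, ε i = -1

end Main

end LieAlgebroidHST

end

/-!
Write `T` for the Nijenhuis torsion of `N = N i`, and `H` for the common `3`-form
`ε (j + 1) · N j dΩ j`. Both kinds of structure satisfy `ε 1 * ε 2 * ε 3 = -1`, which makes
the transition morphisms anticommute and is all that is used about the signs.

The main point is that `N` is a Nijenhuis morphism. Since `Ω (i + 1) = Ω (i - 1) (N ·, ·)` and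
`N² = ± 1`, the expression `t(X, Y, Z) = Ω (i - 1) (T(X, Y), Z)` is a combination of values of
`dΩ (i - 1)` and `dΩ (i + 1)`. Expressed through `H`, it turns out to be totally skew-symmetric
(`IsEpsHST.eval_nijenhuisTorsion`). On the other hand, `T(N X, Y) = -N T(X, Y)`, and a totally
skew-symmetric `t` with this property vanishes (`IsEpsHST.nijenhuisTorsion_eq_zero`).

For a Nijenhuis morphism with `N² = ± 1`, the bracket of `μ_N` is conjugate to that of `μ` by `N`,
which gives the Jacobi identity. The differential of `μ_N` satisfies `d_N Ω = i_N dΩ - d(i_N Ω)`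
whenever `N` is self- or skew-adjoint for `Ω`; with the relation between values of `H` that `T = 0`
amounts to, the torsion condition for `μ_N` follows, the new `3`-form being `i_N H`
(`IsEpsHST.torsionForm_deform`).

Conversely, if the triplet is hypersymplectic with torsion on `μ_N`, then `N` is Nijenhuis for
`μ_N`, hence for `μ` because the torsion of `N` with respect to `μ_N` is `-3 N T`. Deforming `μ_N`
once more by `N` yields `(μ_N)_N = ε i · μ`, so the direct implication applied to `μ_N` gives the
claim for `μ` (`isEpsHST_deform_iff`).
-/

noncomputable section

set_option linter.unusedSectionVars false

namespace LieAlgebroidHST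

variable {E : Type*} [NormedAddCommGroup E] [NormedSpace ℝ E]
  {M : Type*} [TopologicalSpace M] [ChartedSpace E M]
  {F : Type*} [NormedAddCommGroup F] [NormedSpace ℝ F]
  {V : M → Type*} [TopologicalSpace (TotalSpace F V)] [∀ x, AddCommGroup (V x)]
  [∀ x, Module ℝ (V x)] [∀ x, TopologicalSpace (V x)]
  [∀ x, IsTopologicalAddGroup (V x)] [∀ x, ContinuousSMul ℝ (V x)]
  [FiberBundle F V] [VectorBundle ℝ F V]

/-! ### Sections through a given vector -/

/-- Every vector is the value of a global smooth section: a local extension is cut off by a bump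
function. -/
theorem exists_section_apply_eq [FiniteDimensional ℝ E] [IsManifold 𝓘(ℝ, E) ∞ M] [T2Space M]
    [ContMDiffVectorBundle ∞ F V 𝓘(ℝ, E)] (x : M) (v : V x) :
    ∃ X : Sections E F V, X x = v := by
  obtain ⟨s, hs, hsm⟩ := FiberBundle.exists_contMDiffOn_extend 𝓘(ℝ, E) F (k := ∞) v
  obtain ⟨u, hus, huo, hxu⟩ := mem_nhds_iff.1 hs
  obtain ⟨f, -, hf⟩ := (SmoothBumpFunction.nhds_basis_tsupport (I := 𝓘(ℝ, E)) x).mem_iff.1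
    (huo.mem_nhds hxu)
  refine ⟨⟨_, ContMDiffOn.smul_section_of_tsupport f.contMDiff.contMDiffOn huo hf
    (hsm.mono hus)⟩, ?_⟩
  change f x • FiberBundle.extend F v x = v
  rw [f.eq_one, one_smul, FiberBundle.extend_apply_self]

/-! ### Bundle endomorphisms and `2`-forms on sections -/

theorem BundleEnd.apply_zero (N : BundleEnd E F V) : N.apply (0 : Sections E F V) = 0 :=
  ContMDiffSection.ext fun x ↦ map_zero (N x)

theorem BundleEnd.apply_neg (N : BundleEnd E F V) (X : Sections E F V) :
    N.apply (-X) = -N.apply X :=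
  ContMDiffSection.ext fun x ↦ map_neg (N x) (X x)

theorem BundleEnd.apply_sub (N : BundleEnd E F V) (X Y : Sections E F V) :
    N.apply (X - Y) = N.apply X - N.apply Y :=
  ContMDiffSection.ext fun x ↦ map_sub (N x) (X x) (Y x)

namespace NondegenerateTwoForm

variable (Ω : NondegenerateTwoForm E F V)

theorem flat_swap (x : M) (v w : V x) : Ω.flat x v w = -Ω.flat x w v := by
  have h := Ω.alternating x (v + w)
  simp only [map_add, add_apply, Ω.alternating] at h
  linarith

theorem flat_injective (x : M) : Function.Injective (Ω.flat x) := by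
  refine (injective_iff_map_eq_zero _).2 fun v hv ↦ Ω.nondegenerate x v fun w ↦ ?_
  rw [hv]; rfl

theorem eval_swap (X Y : Sections E F V) : Ω.eval X Y = -Ω.eval Y X :=
  funext fun x ↦ Ω.flat_swap x _ _

theorem eval_zero_left (X : Sections E F V) : Ω.eval 0 X = 0 :=
  funext fun x ↦ by simp [eval]

theorem eval_add_left (X Y Z : Sections E F V) : Ω.eval (X + Y) Z = Ω.eval X Z + Ω.eval Y Z :=
  funext fun x ↦ by simp [eval]

theorem eval_sub_left (X Y Z : Sections E F V) : Ω.eval (X - Y) Z = Ω.eval X Z - Ω.eval Y Z :=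
  funext fun x ↦ by simp [eval]

theorem eval_neg_left (X Y : Sections E F V) : Ω.eval (-X) Y = -Ω.eval X Y :=
  funext fun x ↦ by simp [eval]

theorem eval_smul_left (c : ℝ) (X Y : Sections E F V) : Ω.eval (c • X) Y = c • Ω.eval X Y :=
  funext fun x ↦ by simp [eval]

/-- Non-degeneracy tested on global sections. -/
theorem eq_zero_of_eval_eq_zero [FiniteDimensional ℝ E] [IsManifold 𝓘(ℝ, E) ∞ M] [T2Space M]
    [ContMDiffVectorBundle ∞ F V 𝓘(ℝ, E)] {X : Sections E F V}
    (h : ∀ Y, Ω.eval X Y = 0) : X = 0 := by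
  refine ContMDiffSection.ext fun x ↦ Ω.nondegenerate x _ fun w ↦ ?_
  obtain ⟨Y, rfl⟩ := exists_section_apply_eq (E := E) (F := F) x w
  exact congrFun (h Y) x

end NondegenerateTwoForm

/-! ### The differential and the deformation of a pre-Lie algebroid -/

namespace PreLieAlgebroid

variable [IsManifold 𝓘(ℝ, E) ∞ M] (μ : PreLieAlgebroid E F V)

theorem anchorDeriv_neg (X : Sections E F V) (f : M → ℝ) :
    μ.anchorDeriv X (-f) = -μ.anchorDeriv X f := by
  funext x
  simp only [anchorDeriv, derivAlong, Pi.neg_apply]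
  rw [mfderiv_neg]
  rfl

theorem anchorDeriv_smul_left (c : ℝ) (X : Sections E F V) (f : M → ℝ) :
    μ.anchorDeriv (c • X) f = c • μ.anchorDeriv X f := by
  funext x
  simp [anchorDeriv, derivAlong]
  rfl

/-- For a sign `a` no differentiability of `f` is needed. -/
theorem anchorDeriv_sign_smul {a : ℝ} (ha : a = 1 ∨ a = -1) (X : Sections E F V) (f : M → ℝ) :
    μ.anchorDeriv X (a • f) = a • μ.anchorDeriv X f := by
  rcases ha with rfl | rfl
  · simp only [one_smul]
  · simp only [neg_smul, one_smul, anchorDeriv_neg]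

theorem bracket_swap (X Y : Sections E F V) : μ.bracket X Y = -μ.bracket Y X := by
  have h := μ.bracket_self (X + Y)
  simp only [map_add, LinearMap.add_apply, μ.bracket_self, zero_add, add_zero] at h
  exact eq_neg_of_add_eq_zero_right h

theorem d_swap_left (Ω : NondegenerateTwoForm E F V) (X Y Z : Sections E F V) :
    μ.d Ω X Y Z = -μ.d Ω Y X Z := by
  simp only [d]
  rw [μ.bracket_swap Y X, Ω.eval_swap Y X, μ.anchorDeriv_neg, Ω.eval_neg_left]
  abel

theorem d_swap_right (Ω : NondegenerateTwoForm E F V) (X Y Z : Sections E F V) :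
    μ.d Ω X Y Z = -μ.d Ω X Z Y := by
  simp only [d]
  rw [μ.bracket_swap Z Y, Ω.eval_swap Z Y, μ.anchorDeriv_neg, Ω.eval_neg_left]
  abel

theorem d_sign_smul_left (Ω : NondegenerateTwoForm E F V) {a : ℝ} (ha : a = 1 ∨ a = -1)
    (X Y Z : Sections E F V) : μ.d Ω (a • X) Y Z = a • μ.d Ω X Y Z := by
  have h (U : Sections E F V) : Ω.eval U (a • X) = a • Ω.eval U X := by
    rw [Ω.eval_swap, Ω.eval_smul_left, Ω.eval_swap U, smul_neg]
  simp only [d, map_smul, LinearMap.smul_apply, Ω.eval_smul_left, h, anchorDeriv_smul_left,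
    μ.anchorDeriv_sign_smul ha]
  module

theorem d_sign_smul_middle (Ω : NondegenerateTwoForm E F V) {a : ℝ} (ha : a = 1 ∨ a = -1)
    (X Y Z : Sections E F V) : μ.d Ω X (a • Y) Z = a • μ.d Ω X Y Z := by
  rw [d_swap_left, d_sign_smul_left _ _ ha, d_swap_left _ _ X, smul_neg]

theorem d_sign_smul_right (Ω : NondegenerateTwoForm E F V) {a : ℝ} (ha : a = 1 ∨ a = -1)
    (X Y Z : Sections E F V) : μ.d Ω X Y (a • Z) = a • μ.d Ω X Y Z := by
  rw [d_swap_right, d_sign_smul_middle _ _ ha, d_swap_right _ _ X Y, smul_neg]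

theorem deform_bracket (N : BundleEnd E F V) (X Y : Sections E F V) :
    (μ.deform N).bracket X Y =
      μ.bracket (N.apply X) Y + μ.bracket X (N.apply Y) - N.apply (μ.bracket X Y) :=
  rfl

theorem deform_anchorDeriv (N : BundleEnd E F V) (X : Sections E F V) (f : M → ℝ) :
    (μ.deform N).anchorDeriv X f = μ.anchorDeriv (N.apply X) f :=
  rfl

/-- The formula `d_N Ω = i_N dΩ - d(i_N Ω)` for the differential `d_N` of `μ_N`, in the case
`Ω(N X, Y) = Ω(X, N Y) = a Ω'(X, Y)`, where `i_N Ω = 2 a Ω'`. -/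
theorem d_deform_of_selfAdjoint {N : BundleEnd E F V} {Ω Ω' : NondegenerateTwoForm E F V} {a : ℝ}
    (ha : a = 1 ∨ a = -1) (hl : ∀ X Y, Ω.eval (N.apply X) Y = a • Ω'.eval X Y)
    (hr : ∀ X Y, Ω.eval X (N.apply Y) = a • Ω'.eval X Y) (X Y Z : Sections E F V) :
    (μ.deform N).d Ω X Y Z = μ.d Ω (N.apply X) Y Z + μ.d Ω X (N.apply Y) Z
      + μ.d Ω X Y (N.apply Z) - (2 * a) • μ.d Ω' X Y Z := by
  simp only [d, deform_bracket, deform_anchorDeriv, Ω.eval_add_left, Ω.eval_sub_left, hl, hr,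
    μ.anchorDeriv_sign_smul ha]
  module

/-- The same formula in the case `Ω(N X, Y) = -Ω(X, N Y)`, where `i_N Ω = 0`. -/
theorem d_deform_of_skewAdjoint {N : BundleEnd E F V} {Ω : NondegenerateTwoForm E F V}
    (h : ∀ X Y, Ω.eval (N.apply X) Y = -Ω.eval X (N.apply Y)) (X Y Z : Sections E F V) :
    (μ.deform N).d Ω X Y Z = μ.d Ω (N.apply X) Y Z + μ.d Ω X (N.apply Y) Z
      + μ.d Ω X Y (N.apply Z) := by
  simp only [d, deform_bracket, deform_anchorDeriv, Ω.eval_add_left, Ω.eval_sub_left, h,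
    μ.anchorDeriv_neg]
  abel

/-! ### The Nijenhuis torsion -/

/-- The Nijenhuis torsion `[N X, N Y] - N [X, Y]_N` of a bundle endomorphism `N`. -/
def nijenhuisTorsion (N : BundleEnd E F V) (X Y : Sections E F V) : Sections E F V :=
  μ.bracket (N.apply X) (N.apply Y) - N.apply ((μ.deform N).bracket X Y)

theorem nijenhuisTorsion_swap (N : BundleEnd E F V) (X Y : Sections E F V) :
    μ.nijenhuisTorsion N X Y = -μ.nijenhuisTorsion N Y X := by
  simp only [nijenhuisTorsion]
  rw [bracket_swap, (μ.deform N).bracket_swap X, N.apply_neg]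
  abel

section Square

variable {N : BundleEnd E F V} {a : ℝ} (hN : ∀ X, N.apply (N.apply X) = a • X)
include hN

theorem nijenhuisTorsion_apply_left (X Y : Sections E F V) :
    μ.nijenhuisTorsion N (N.apply X) Y = -N.apply (μ.nijenhuisTorsion N X Y) := by
  simp only [nijenhuisTorsion, deform_bracket, N.apply_add, N.apply_sub, hN, map_smul,
    LinearMap.smul_apply, N.apply_smul]
  abel

/-- For `N² = ± 1`, this makes `N` Nijenhuis for `μ` as soon as it is Nijenhuis for `μ_N`. -/
theorem nijenhuisTorsion_deform (X Y : Sections E F V) :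
    (μ.deform N).nijenhuisTorsion N X Y = (-3 : ℝ) • N.apply (μ.nijenhuisTorsion N X Y) := by
  simp only [nijenhuisTorsion, deform_bracket, N.apply_add, N.apply_sub, hN, map_smul,
    LinearMap.smul_apply, N.apply_smul]
  module

/-- If `Ω' = Ω(N ·, ·)` is skew-symmetric and `N² = a`, then the Nijenhuis torsion of `N` is
determined by `dΩ` and `dΩ'`: in this combination of values of `dΩ` and `dΩ'` all derivatives along
the anchor cancel, and so do all brackets other than those of the torsion. -/
theorem eval_nijenhuisTorsion {Ω Ω' : NondegenerateTwoForm E F V} (ha : a = 1 ∨ a = -1)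
    (hl : ∀ X Y, Ω.eval (N.apply X) Y = Ω'.eval X Y)
    (hr : ∀ X Y, Ω.eval X (N.apply Y) = Ω'.eval X Y)
    (hl' : ∀ X Y, Ω'.eval (N.apply X) Y = a • Ω.eval X Y)
    (hr' : ∀ X Y, Ω'.eval X (N.apply Y) = a • Ω.eval X Y) (X Y Z : Sections E F V) :
    Ω.eval (μ.nijenhuisTorsion N X Y) Z =
      μ.d Ω' (N.apply X) Y Z + μ.d Ω' X (N.apply Y) Z
        - μ.d Ω (N.apply X) (N.apply Y) Z - a • μ.d Ω X Y Z := by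
  simp only [d, nijenhuisTorsion, deform_bracket, N.apply_add, N.apply_sub, hN, Ω.eval_add_left,
    Ω.eval_sub_left, Ω.eval_smul_left, hl, hr, hl', hr', μ.anchorDeriv_sign_smul ha]
  module

section Nijenhuis

variable (ha : a = 1 ∨ a = -1) (hT : ∀ X Y, μ.nijenhuisTorsion N X Y = 0)
include ha hT

/-- For an invertible Nijenhuis morphism `N`, the deformed bracket is conjugate to the original one
by `N`. -/
theorem deform_bracket_of_nijenhuis (X Y : Sections E F V) :
    (μ.deform N).bracket X Y = a • N.apply (μ.bracket (N.apply X) (N.apply Y)) := by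
  have haa : a * a = 1 := by rcases ha with rfl | rfl <;> norm_num
  rw [sub_eq_zero.1 (hT X Y), hN, smul_smul, haa, one_smul]

/-- The Jacobi identity is transported along the conjugation by `N`. -/
theorem isLieAlgebroid_deform (hμ : μ.IsLieAlgebroid) : (μ.deform N).IsLieAlgebroid := by
  have haa : a * a = 1 := by rcases ha with rfl | rfl <;> norm_num
  intro X Y Z
  have h := hμ (N.apply X) (N.apply Y) (N.apply Z)
  simp only [μ.deform_bracket_of_nijenhuis hN ha hT, N.apply_smul, hN, smul_smul, haa, one_smul]
  rw [← smul_add, ← smul_add, ← N.apply_add, ← N.apply_add, h, N.apply_zero, smul_zero]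

/-- For a Nijenhuis morphism with `N² = a`, deforming twice multiplies the structure by `a`. -/
theorem d_deform_deform (hT' : ∀ X Y, (μ.deform N).nijenhuisTorsion N X Y = 0)
    (Ω : NondegenerateTwoForm E F V) (X Y Z : Sections E F V) :
    ((μ.deform N).deform N).d Ω X Y Z = a • μ.d Ω X Y Z := by
  have haa : a * a = 1 := by rcases ha with rfl | rfl <;> norm_num
  simp only [d, deform_anchorDeriv, (μ.deform N).deform_bracket_of_nijenhuis hN ha hT',
    μ.deform_bracket_of_nijenhuis hN ha hT, N.apply_smul, hN, map_smul, LinearMap.smul_apply,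
    smul_smul, haa, one_smul, anchorDeriv_smul_left, Ω.eval_smul_left]
  module

end Nijenhuis

end Square

end PreLieAlgebroid

/-! ### Transition morphisms -/

section Transition

variable [FiniteDimensional ℝ F] (Ω : ZMod 3 → NondegenerateTwoForm E F V)

theorem flat_transition (i : ZMod 3) (x : M) (v : V x) :
    (Ω (i - 1)).flat x (transition Ω i x v) = (Ω (i + 1)).flat x v := by
  obtain ⟨e, he⟩ := (Ω (i - 1)).isInvertible x
  change (Ω (i - 1)).flat x (((Ω (i - 1)).flat x).inverse ((Ω (i + 1)).flat x v)) = _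
  rw [← he, ContinuousLinearMap.inverse_equiv]
  exact e.apply_symm_apply _

theorem add_one_add_one_eq (i : ZMod 3) : i + 1 + 1 = i - 1 := by
  revert i; decide

theorem sub_one_sub_one_eq (i : ZMod 3) : i - 1 - 1 = i + 1 := by
  revert i; decide

theorem eq_or_eq_add_one_or_eq_sub_one (i j : ZMod 3) : j = i ∨ j = i + 1 ∨ j = i - 1 := by
  revert i j; decide

theorem transition_comp_comp (i : ZMod 3) (X : Sections E F V) :
    (transition Ω (i + 1)).apply ((transition Ω i).apply ((transition Ω (i - 1)).apply X)) = X := by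
  refine ContMDiffSection.ext fun x ↦ (Ω i).flat_injective x ?_
  have h₁ := flat_transition Ω (i + 1) x
  have h₂ := flat_transition Ω i x
  have h₃ := flat_transition Ω (i - 1) x
  rw [add_sub_cancel_right, add_one_add_one_eq] at h₁
  rw [sub_add_cancel, sub_one_sub_one_eq] at h₃
  exact (h₁ _).trans ((h₂ _).trans (h₃ _))

theorem eval_transition_left (i : ZMod 3) (X Y : Sections E F V) :
    (Ω (i - 1)).eval ((transition Ω i).apply X) Y = (Ω (i + 1)).eval X Y :=
  funext fun x ↦ congrArg (· (Y x)) (flat_transition Ω i x (X x))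

theorem eval_transition_right (i : ZMod 3) (X Y : Sections E F V) :
    (Ω (i - 1)).eval X ((transition Ω i).apply Y) = (Ω (i + 1)).eval X Y := by
  rw [NondegenerateTwoForm.eval_swap, eval_transition_left, ← NondegenerateTwoForm.eval_swap]

end Transition

/-! ### Hypersymplectic structures with torsion -/

section HST

variable [IsManifold 𝓘(ℝ, E) ∞ M] [FiniteDimensional ℝ F] {μ : PreLieAlgebroid E F V}
  {ε : ZMod 3 → ℝ} {Ω : ZMod 3 → NondegenerateTwoForm E F V}

/-- The value on sections of the `3`-form `ε (i + 1) · N i dΩ i`, which does not depend on `i` for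
an `ε`-hypersymplectic structure with torsion. -/
def torsionForm (μ : PreLieAlgebroid E F V) (ε : ZMod 3 → ℝ)
    (Ω : ZMod 3 → NondegenerateTwoForm E F V) (i : ZMod 3) (X Y Z : Sections E F V) : M → ℝ :=
  ε (i + 1) • μ.d (Ω i) ((transition Ω i).apply X) ((transition Ω i).apply Y)
    ((transition Ω i).apply Z)

theorem torsionForm_swap_left (i : ZMod 3) (X Y Z : Sections E F V) :
    torsionForm μ ε Ω i X Y Z = -torsionForm μ ε Ω i Y X Z := by
  rw [torsionForm, μ.d_swap_left, smul_neg, torsionForm]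

theorem torsionForm_swap_right (i : ZMod 3) (X Y Z : Sections E F V) :
    torsionForm μ ε Ω i X Y Z = -torsionForm μ ε Ω i X Z Y := by
  rw [torsionForm, μ.d_swap_right, smul_neg, torsionForm]

theorem torsionForm_neg_left (i : ZMod 3) (X Y Z : Sections E F V) :
    torsionForm μ ε Ω i (-X) Y Z = -torsionForm μ ε Ω i X Y Z := by
  have h := μ.d_sign_smul_left (Ω i) (a := -1) (.inr rfl) ((transition Ω i).apply X)
    ((transition Ω i).apply Y) ((transition Ω i).apply Z)
  rw [neg_one_smul, neg_one_smul] at h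
  rw [torsionForm, BundleEnd.apply_neg, h, smul_neg, torsionForm]

theorem torsionForm_neg_middle (i : ZMod 3) (X Y Z : Sections E F V) :
    torsionForm μ ε Ω i X (-Y) Z = -torsionForm μ ε Ω i X Y Z := by
  rw [torsionForm_swap_left, torsionForm_neg_left, torsionForm_swap_left _ X]

theorem torsionForm_neg_right (i : ZMod 3) (X Y Z : Sections E F V) :
    torsionForm μ ε Ω i X Y (-Z) = -torsionForm μ ε Ω i X Y Z := by
  rw [torsionForm_swap_right, torsionForm_neg_middle, torsionForm_swap_right _ X Y]

namespace IsEpsHST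

variable (h : IsEpsHST μ ε Ω)
include h

theorem eps_mul_self (i : ZMod 3) : ε i * ε i = 1 := by
  rcases h.eps i with h | h <;> simp [h]

theorem eps_ne_zero (i : ZMod 3) : ε i ≠ 0 :=
  left_ne_zero_of_mul_eq_one (h.eps_mul_self i)

theorem transition_transition (i : ZMod 3) (X : Sections E F V) :
    (transition Ω i).apply ((transition Ω i).apply X) = ε i • X :=
  ContMDiffSection.ext fun x ↦ h.sq i x (X x)

/-- Each `dΩ j` is recovered from the torsion form, as `N j` is invertible. -/
theorem d_eq_torsionForm (i j : ZMod 3) (X Y Z : Sections E F V) :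
    μ.d (Ω j) X Y Z = (ε j * ε (j + 1)) • torsionForm μ ε Ω i ((transition Ω j).apply X)
      ((transition Ω j).apply Y) ((transition Ω j).apply Z) := by
  rw [torsionForm, h.torsion i j]
  simp only [h.transition_transition, μ.d_sign_smul_left _ (h.eps j),
    μ.d_sign_smul_middle _ (h.eps j), μ.d_sign_smul_right _ (h.eps j), smul_smul]
  rcases h.eps j with h₁ | h₁ <;> rcases h.eps (j + 1) with h₂ | h₂ <;> simp [h₁, h₂]

theorem transition_succ_comp (i : ZMod 3) (X : Sections E F V) :
    (transition Ω (i + 1)).apply ((transition Ω i).apply X) =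
      ε (i - 1) • (transition Ω (i - 1)).apply X := by
  have hε : ε (i - 1) * ε (i - 1) = 1 := h.eps_mul_self (i - 1)
  have h₁ := transition_comp_comp Ω i ((transition Ω (i - 1)).apply X)
  rw [h.transition_transition, BundleEnd.apply_smul, BundleEnd.apply_smul] at h₁
  rw [← h₁, smul_smul, hε, one_smul]

theorem eval_transition_transition_left (i : ZMod 3) (X Y : Sections E F V) :
    (Ω (i + 1)).eval ((transition Ω i).apply X) Y = ε i • (Ω (i - 1)).eval X Y := by
  rw [← eval_transition_left, h.transition_transition, NondegenerateTwoForm.eval_smul_left]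

theorem eval_transition_transition_right (i : ZMod 3) (X Y : Sections E F V) :
    (Ω (i + 1)).eval X ((transition Ω i).apply Y) = ε i • (Ω (i - 1)).eval X Y := by
  rw [NondegenerateTwoForm.eval_swap, h.eval_transition_transition_left,
    (Ω (i - 1)).eval_swap X, smul_neg]

variable (hε : ∀ i, ε i * ε (i + 1) * ε (i - 1) = -1)
include hε

/-- The condition on the signs makes the transition morphisms anticommute. -/
theorem transition_comp_succ (i : ZMod 3) (X : Sections E F V) :
    (transition Ω i).apply ((transition Ω (i + 1)).apply X) =
      -(ε (i - 1) • (transition Ω (i - 1)).apply X) := by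
  have h₀ : ε i * ε i = 1 := h.eps_mul_self i
  have h₁ : ε (i + 1) * ε (i + 1) = 1 := h.eps_mul_self (i + 1)
  have h₂ : -ε (i - 1) = ε i * ε (i + 1) := by
    linear_combination ε (i - 1) * h₀ + ε i * ε i * ε (i - 1) * h₁ - ε i * ε (i + 1) * hε i
  -- `N (i + 1) = ε (i + 1) · N i N (i - 1)`, by cyclic symmetry
  have h₃ := h.transition_succ_comp (i - 1) X
  rw [sub_add_cancel, sub_one_sub_one_eq] at h₃
  have h₄ : (transition Ω (i + 1)).apply X =
      ε (i + 1) • (transition Ω i).apply ((transition Ω (i - 1)).apply X) := by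
    rw [h₃, smul_smul, h₁, one_smul]
  rw [h₄, BundleEnd.apply_smul, h.transition_transition, smul_smul, ← neg_smul, h₂, mul_comm]

/-- `N i` is skew-adjoint for `Ω i`, whereas it is self-adjoint for the other two forms. -/
theorem eval_transition_self (i : ZMod 3) (X Y : Sections E F V) :
    (Ω i).eval ((transition Ω i).apply X) Y = -(Ω i).eval X ((transition Ω i).apply Y) := by
  have hi : ε (i + 1) ≠ 0 := h.eps_ne_zero (i + 1)
  have hl := h.eval_transition_transition_left (i + 1)
  rw [add_one_add_one_eq, add_sub_cancel_right] at hl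
  have hanti : (transition Ω (i + 1)).apply ((transition Ω i).apply X) =
      -(transition Ω i).apply ((transition Ω (i + 1)).apply X) := by
    rw [h.transition_succ_comp, h.transition_comp_succ hε, neg_neg]
  refine smul_right_injective _ hi ?_
  simp only [smul_neg]
  rw [← hl, ← hl, hanti, NondegenerateTwoForm.eval_neg_left, eval_transition_left,
    eval_transition_right]

/-- The form `Ω (i - 1) (T ·, ·)`, for `T` the Nijenhuis torsion of `N i`, in terms of the torsion
form; it is visibly totally skew-symmetric. -/
theorem eval_nijenhuisTorsion (i : ZMod 3) (X Y Z : Sections E F V) :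
    (Ω (i - 1)).eval (μ.nijenhuisTorsion (transition Ω i) X Y) Z =
      ε (i + 1) • (torsionForm μ ε Ω i ((transition Ω (i + 1)).apply X)
          ((transition Ω (i + 1)).apply Y) ((transition Ω (i - 1)).apply Z)
        + torsionForm μ ε Ω i ((transition Ω (i - 1)).apply X)
          ((transition Ω (i + 1)).apply Y) ((transition Ω (i + 1)).apply Z)
        + torsionForm μ ε Ω i ((transition Ω (i + 1)).apply X)
          ((transition Ω (i - 1)).apply Y) ((transition Ω (i + 1)).apply Z))
      - ε (i - 1) • torsionForm μ ε Ω i ((transition Ω (i - 1)).apply X)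
          ((transition Ω (i - 1)).apply Y) ((transition Ω (i - 1)).apply Z) := by
  have hc := h.transition_comp_succ hε (i - 1)
  rw [sub_one_sub_one_eq, sub_add_cancel] at hc
  have hp := hε i
  rw [μ.eval_nijenhuisTorsion (h.transition_transition i) (h.eps i) (eval_transition_left Ω i)
    (eval_transition_right Ω i) (h.eval_transition_transition_left i)
    (h.eval_transition_transition_right i)]
  simp only [h.d_eq_torsionForm i (i + 1), h.d_eq_torsionForm i (i - 1), h.transition_succ_comp i,
    hc, add_one_add_one_eq, sub_add_cancel]
  -- `norm_num` discards the sign patterns excluded by `hp`, whose number of minus signs is even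
  rcases h.eps i with h₀ | h₀ <;> rcases h.eps (i + 1) with h₁ | h₁ <;>
    rcases h.eps (i - 1) with h₂ | h₂ <;> rw [h₀, h₁, h₂] at hp <;> norm_num at hp <;>
    simp only [h₀, h₁, h₂, one_smul, neg_smul, neg_neg, torsionForm_neg_left,
      torsionForm_neg_middle] <;> module

/-- The transition morphisms are Nijenhuis: `t = Ω (i - 1) (T ·, ·)` is totally skew-symmetric, and
`t(N X, Y, Z) = -t(X, Y, N Z)` because `T(N X, Y) = -N T(X, Y)`. Moving `N` around the three
arguments, one sign is left over. -/
theorem nijenhuisTorsion_eq_zero [FiniteDimensional ℝ E] [T2Space M]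
    [ContMDiffVectorBundle ∞ F V 𝓘(ℝ, E)] (i : ZMod 3) (X Y : Sections E F V) :
    μ.nijenhuisTorsion (transition Ω i) X Y = 0 := by
  set N := transition Ω i with hN
  let t (X Y Z : Sections E F V) : M → ℝ := (Ω (i - 1)).eval (μ.nijenhuisTorsion N X Y) Z
  have hleft (X Y Z) : t X Y Z = -t Y X Z := by
    simp only [t]
    rw [μ.nijenhuisTorsion_swap, NondegenerateTwoForm.eval_neg_left]
  have hright (X Y Z) : t X Y Z = -t X Z Y := by
    simp only [t, hN, h.eval_nijenhuisTorsion hε]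
    rw [torsionForm_swap_right _ _ ((transition Ω (i + 1)).apply Z)
        ((transition Ω (i - 1)).apply Y),
      torsionForm_swap_right _ _ ((transition Ω (i + 1)).apply Z) ((transition Ω (i + 1)).apply Y),
      torsionForm_swap_right _ _ ((transition Ω (i - 1)).apply Z) ((transition Ω (i + 1)).apply Y),
      torsionForm_swap_right _ _ ((transition Ω (i - 1)).apply Z) ((transition Ω (i - 1)).apply Y)]
    module
  have hmove (X Y Z) : t (N.apply X) Y Z = -t X Y (N.apply Z) := by
    simp only [t]
    rw [μ.nijenhuisTorsion_apply_left (h.transition_transition i),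
      NondegenerateTwoForm.eval_neg_left, eval_transition_left, eval_transition_right]
  refine (Ω (i + 1)).eq_zero_of_eval_eq_zero fun Z ↦ ?_
  have h₁ : t X (N.apply Y) Z = -t X Y (N.apply Z) := by
    rw [hleft, hmove, hleft Y, neg_neg]
  have h₂ : t X (N.apply Y) Z = t X Y (N.apply Z) := by
    rw [hright, ← hmove, hright, hmove, neg_neg]
  have h₃ : t X Y (N.apply Z) = 0 := self_eq_neg.1 (h₂.symm.trans h₁)
  rwa [← eval_transition_right]

/-- The vanishing of the Nijenhuis torsion of `N i`, as a property of the torsion form. It makes the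
three cases of `torsionForm_deform` agree. -/
theorem torsionForm_transition [FiniteDimensional ℝ E] [T2Space M]
    [ContMDiffVectorBundle ∞ F V 𝓘(ℝ, E)] (i : ZMod 3) (X Y Z : Sections E F V) :
    torsionForm μ ε Ω i ((transition Ω i).apply X) Y Z
      + torsionForm μ ε Ω i X ((transition Ω i).apply Y) Z
      + torsionForm μ ε Ω i X Y ((transition Ω i).apply Z) =
    -(ε i • torsionForm μ ε Ω i ((transition Ω i).apply X) ((transition Ω i).apply Y)
      ((transition Ω i).apply Z)) := by
  have hs := h.transition_succ_comp (i + 1)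
  rw [add_one_add_one_eq, add_sub_cancel_right] at hs
  have hp := hε i
  -- applying `N (i + 1)` to `X`, `Y`, `Z` turns the arguments of the torsion form there into
  -- multiples of the sections themselves and of their images under `N i`
  have ht := h.eval_nijenhuisTorsion hε i ((transition Ω (i + 1)).apply X)
    ((transition Ω (i + 1)).apply Y) ((transition Ω (i + 1)).apply Z)
  rw [h.nijenhuisTorsion_eq_zero hε, NondegenerateTwoForm.eval_zero_left] at ht
  simp only [h.transition_transition, hs] at ht
  funext x
  have htx := congrFun ht x
  rcases h.eps i with h₀ | h₀ <;> rcases h.eps (i + 1) with h₁ | h₁ <;>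
    rcases h.eps (i - 1) with h₂ | h₂ <;> rw [h₀, h₁, h₂] at hp <;> norm_num at hp <;>
    simp only [h₀, h₁, h₂, one_smul, neg_smul, neg_neg, torsionForm_neg_left,
      torsionForm_neg_middle, torsionForm_neg_right, Pi.add_apply, Pi.sub_apply, Pi.neg_apply,
      Pi.zero_apply] at htx ⊢ <;> linarith

/-- The torsion form of the deformed structure is `i_N` of the original one. -/
theorem torsionForm_deform [FiniteDimensional ℝ E] [T2Space M]
    [ContMDiffVectorBundle ∞ F V 𝓘(ℝ, E)] (i j : ZMod 3) (X Y Z : Sections E F V) :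
    torsionForm (μ.deform (transition Ω i)) ε Ω j X Y Z =
      torsionForm μ ε Ω i ((transition Ω i).apply X) Y Z
      + torsionForm μ ε Ω i X ((transition Ω i).apply Y) Z
      + torsionForm μ ε Ω i X Y ((transition Ω i).apply Z) := by
  have hp := hε i
  have ht := h.torsionForm_transition hε i X Y Z
  have hqp := h.transition_succ_comp (i + 1)
  have hnq := h.transition_succ_comp (i - 1)
  have hnp := h.transition_comp_succ hε i
  have hpq := h.transition_comp_succ hε (i + 1)
  rw [add_one_add_one_eq, add_sub_cancel_right] at hqp hpq
  rw [sub_one_sub_one_eq, sub_add_cancel] at hnq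
  have hd : ∀ X Y Z, torsionForm (μ.deform (transition Ω i)) ε Ω j X Y Z = ε (j + 1) •
    (μ.deform (transition Ω i)).d (Ω j) ((transition Ω j).apply X) ((transition Ω j).apply Y)
      ((transition Ω j).apply Z) := fun _ _ _ ↦ rfl
  rw [hd]
  funext x
  have htx := congrFun ht x
  rcases eq_or_eq_add_one_or_eq_sub_one i j with rfl | rfl | rfl
  -- `N i` is skew-adjoint for `Ω i`
  · rw [μ.d_deform_of_skewAdjoint (h.eval_transition_self hε j)]
    simp only [h.d_eq_torsionForm j j, h.transition_transition, BundleEnd.apply_smul]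
    rcases h.eps j with h₀ | h₀ <;> rcases h.eps (j + 1) with h₁ | h₁ <;>
      simp [h₀, h₁, torsionForm_neg_left, torsionForm_neg_middle, torsionForm_neg_right] <;>
      ring
  -- `N i` is self-adjoint for `Ω (i + 1)`, and `Ω (i + 1) (N i ·, ·) = ε i Ω (i - 1)`
  · rw [μ.d_deform_of_selfAdjoint (h.eps i) (h.eval_transition_transition_left i)
      (h.eval_transition_transition_right i)]
    simp only [h.d_eq_torsionForm i, h.transition_transition, hqp, hnp, add_one_add_one_eq,
      sub_add_cancel]
    rcases h.eps i with h₀ | h₀ <;> rcases h.eps (i + 1) with h₁ | h₁ <;>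
      rcases h.eps (i - 1) with h₂ | h₂ <;> rw [h₀, h₁, h₂] at hp <;> norm_num at hp <;>
      simp [h₀, h₁, h₂, torsionForm_neg_left, torsionForm_neg_middle, torsionForm_neg_right,
        BundleEnd.apply_neg, hpq] at htx ⊢ <;>
      linarith
  -- `N i` is self-adjoint for `Ω (i - 1)`, and `Ω (i - 1) (N i ·, ·) = Ω (i + 1)`
  · rw [μ.d_deform_of_selfAdjoint (a := 1) (.inl rfl)
      (by simpa only [one_smul] using eval_transition_left Ω i)
      (by simpa only [one_smul] using eval_transition_right Ω i)]
    simp only [h.d_eq_torsionForm i, h.transition_transition, BundleEnd.apply_smul, hqp, hnq,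
      hpq, add_one_add_one_eq, sub_add_cancel]
    rcases h.eps i with h₀ | h₀ <;> rcases h.eps (i + 1) with h₁ | h₁ <;>
      rcases h.eps (i - 1) with h₂ | h₂ <;> rw [h₀, h₁, h₂] at hp <;> norm_num at hp <;>
      simp [h₀, h₁, h₂, torsionForm_neg_left, torsionForm_neg_middle, torsionForm_neg_right]
        at htx ⊢ <;>
      linarith

theorem deform [FiniteDimensional ℝ E] [T2Space M] [ContMDiffVectorBundle ∞ F V 𝓘(ℝ, E)]
    (i : ZMod 3) : IsEpsHST (μ.deform (transition Ω i)) ε Ω where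
  isLieAlgebroid := μ.isLieAlgebroid_deform (h.transition_transition i) (h.eps i)
    (h.nijenhuisTorsion_eq_zero hε i) h.isLieAlgebroid
  eps := h.eps
  sq := h.sq
  torsion j k X Y Z :=
    (h.torsionForm_deform hε i j X Y Z).trans (h.torsionForm_deform hε i k X Y Z).symm

end IsEpsHST

/-- The converse direction rests on deforming once more: `(μ_N)_N` is a multiple of `μ`. -/
theorem isEpsHST_deform_iff [FiniteDimensional ℝ E] [T2Space M]
    [ContMDiffVectorBundle ∞ F V 𝓘(ℝ, E)] (hμ : μ.IsLieAlgebroid)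
    (hε : ∀ i, ε i * ε (i + 1) * ε (i - 1) = -1) (i : ZMod 3) :
    IsEpsHST μ ε Ω ↔ IsEpsHST (μ.deform (transition Ω i)) ε Ω := by
  refine ⟨fun h ↦ h.deform hε i, fun h ↦ ⟨hμ, h.eps, h.sq, fun j k X Y Z ↦ ?_⟩⟩
  have hi : ε i ≠ 0 := h.eps_ne_zero i
  have hN := h.transition_transition i
  have hT' := h.nijenhuisTorsion_eq_zero hε i
  have hT (X Y) : μ.nijenhuisTorsion (transition Ω i) X Y = 0 := by
    have h₁ := hT' X Y
    rw [μ.nijenhuisTorsion_deform hN] at h₁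
    have h₂ := (smul_eq_zero.1 h₁).resolve_left (by norm_num)
    have h₃ := hN (μ.nijenhuisTorsion (transition Ω i) X Y)
    rw [h₂] at h₃
    exact (smul_eq_zero.1 (h₃.symm.trans (transition Ω i).apply_zero)).resolve_left hi
  have ht := (h.deform hε i).torsion j k X Y Z
  rw [μ.d_deform_deform hN (h.eps i) hT hT', μ.d_deform_deform hN (h.eps i) hT hT',
    smul_comm, smul_comm (ε (k + 1))] at ht
  exact smul_right_injective _ hi ht

end HST

end LieAlgebroidHST

end

theorem mainTheorem4
    {E : Type*} [NormedAddCommGroup E] [NormedSpace ℝ E] [FiniteDimensional ℝ E]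
    {M : Type*} [TopologicalSpace M] [ChartedSpace E M] [IsManifold 𝓘(ℝ, E) ∞ M]
    [T2Space M] [SigmaCompactSpace M]
    {F : Type*} [NormedAddCommGroup F] [NormedSpace ℝ F] [FiniteDimensional ℝ F]
    {V : M → Type*} [TopologicalSpace (TotalSpace F V)] [∀ x, AddCommGroup (V x)]
    [∀ x, Module ℝ (V x)] [∀ x, TopologicalSpace (V x)]
    [∀ x, IsTopologicalAddGroup (V x)] [∀ x, ContinuousSMul ℝ (V x)]
    [FiberBundle F V] [VectorBundle ℝ F V] [ContMDiffVectorBundle ∞ F V 𝓘(ℝ, E)]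
    (μ : LieAlgebroidHST.PreLieAlgebroid E F V) (hμ : μ.IsLieAlgebroid)
    (Ω : ZMod 3 → LieAlgebroidHST.NondegenerateTwoForm E F V) (ε : ZMod 3 → ℝ) (i : ZMod 3) :
    (LieAlgebroidHST.IsHypersymplecticWithTorsion μ ε Ω ↔
      LieAlgebroidHST.IsHypersymplecticWithTorsion
        (μ.deform (LieAlgebroidHST.transition Ω i)) ε Ω) ∧
    (LieAlgebroidHST.IsParaHypersymplecticWithTorsion μ ε Ω ↔
      LieAlgebroidHST.IsParaHypersymplecticWithTorsion
        (μ.deform (LieAlgebroidHST.transition Ω i)) ε Ω) := by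
  have hpara (h : ε 1 * ε 2 * ε 3 = -1) (j : ZMod 3) : ε j * ε (j + 1) * ε (j - 1) = -1 := by
    have h3 : (3 : ZMod 3) = 0 := rfl
    have hj : j = 0 ∨ j = 1 ∨ j = 2 := by revert j; decide
    rw [h3] at h
    rcases hj with rfl | rfl | rfl
    · rw [show (0 : ZMod 3) + 1 = 1 from rfl, show (0 : ZMod 3) - 1 = 2 from rfl]
      linear_combination h
    · rw [show (1 : ZMod 3) + 1 = 2 from rfl, show (1 : ZMod 3) - 1 = 0 from rfl]
      linear_combination h
    · rw [show (2 : ZMod 3) + 1 = 0 from rfl, show (2 : ZMod 3) - 1 = 1 from rfl]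
      linear_combination h
  have hhyp (h : ∀ j, ε j = -1) (j : ZMod 3) : ε j * ε (j + 1) * ε (j - 1) = -1 := by
    norm_num [h]
  exact ⟨and_congr_left fun h ↦ LieAlgebroidHST.isEpsHST_deform_iff hμ (hhyp h) i,
    and_congr_left fun h ↦ LieAlgebroidHST.isEpsHST_deform_iff hμ (hpara h.1) i⟩
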